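/- Let $a\in\mathbb R$ and let $h$ be a meromorphic function on $\mathbb C$, real on the real axis, with finitely many poles in $\mathbb C$ and finitely many zeros in the half-plane $\Re s>a$, holomorphic and without zeros on the line $\Re s=a$. Put $$f^{\pm}(s)=h(s)\pm h(2a-s),\qquad F(s)=\frac{h(2a-s)}{h(s)},$$ and suppose that (i) for every $\eta>0$ there is $\sigma_0>a$ such that $|F(s)|<\eta$ whenever $\Re s\ge\sigma_0$; (ii) for every $\varepsilon>0$ and every $\sigma_0>a$ there is a sequence $T_n\to+\infty$ such that $|F(s)|<e^{\varepsilon|s|}$ whenever $a\le\Re s\le\sigma_0$ and $|\Im s|=T_n$ for some $n$. (In (i) and (ii) it is understood that $F$ has no pole at the points $s$ considered.) Let $\theta(\tau)=\arg h(a+i\tau)$ be the continuous determination of the argument of $h$ on the line $\Re s=a$ with $\theta(0)=0$; if $h(a)<0$, take that of $-h$. For a choice of sign, let $f=f^{\pm}$, let $N_0'(T)$ be the number of zeros of $f$ on the line $\Re s=a$ with $0<\Im s<T$, counted without multiplicity, and let $u_+=\tfrac12$, $u_-=1$. Then: 1. For both signs, $N_0'(T)$ is finite for every $T$, and $N_0'(T)=\frac1\pi\theta(T)+O(1)$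 for $T>0$. 2. For both signs there is an integer $d_{f,a}\ge 0$ such that $$N_0'(T)=\Bigl\lceil \tfrac1\pi\theta(T)-u_{\pm}\Bigr\rceil+d_{f,a}$$ for all sufficiently large $T$; and $d_{f,a}=0$ if $\theta$ is nondecreasing on $[0,\infty)$. 3. The zeros of $f^+$ and $f^-$ are ultimately simple and interlaced: there is $T_0>0$ such that every zero $s$ of $f^+$ or of $f^-$ with $|\Im s|>T_0$ is simple and satisfies $\Re s=a$, and such that, on each of the half-lines $\{a+i\tau:\tau>T_0\}$ and $\{a+i\tau:\tau<-T_0\}$, $f^+$ and $f^-$ have no common zero, and strictly between any two distinct zeros of one of them there is a zero of the other. -/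

import Mathlib

/-- The reflected sum `f(s) = h(s) ± h(2a - s)`; the sign is `e = 1` or `e = -1`. -/
noncomputable def reflSum (a : ℝ) (h : ℂ → ℂ) (e : ℤˣ) (s : ℂ) : ℂ :=
  h s + ((e : ℤ) : ℂ) * h (2 * (a : ℂ) - s)

/-- The quotient `F(s) = h(2a - s) / h(s)`. -/
noncomputable def reflQuot (a : ℝ) (h : ℂ → ℂ) (s : ℂ) : ℂ :=
  h (2 * (a : ℂ) - s) / h s

/-- The zeros of a meromorphic function `g`: the points where its order is positive. -/
def zerosOf (g : ℂ → ℂ) : Set ℂ := {s | 0 < meromorphicOrderAt g s}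

/-- The poles of a meromorphic function `g`: the points where its order is negative. -/
def polesOf (g : ℂ → ℂ) : Set ℂ := {s | meromorphicOrderAt g s < 0}

/-- The zeros of `g` on the line `Re s = a` with `0 < Im s < T`. -/
def criticalZeros (a : ℝ) (g : ℂ → ℂ) (T : ℝ) : Set ℂ :=
  {s | s ∈ zerosOf g ∧ s.re = a ∧ 0 < s.im ∧ s.im < T}

/-- `N₀'(T)`: the number of zeros of `g` on the line `Re s = a` with `0 < Im s < T`,
counted without multiplicity. -/
noncomputable def numCriticalZeros (a : ℝ) (g : ℂ → ℂ) (T : ℝ) : ℕ :=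
  (criticalZeros a g T).ncard

/-- The ordinates of the zeros of `g` on the line `Re s = a`. -/
def criticalOrdinates (a : ℝ) (g : ℂ → ℂ) : Set ℝ :=
  {τ | (a : ℂ) + (τ : ℂ) * Complex.I ∈ zerosOf g}

/-- The constants `u₊ = 1/2` and `u₋ = 1`. -/
noncomputable def phaseShift (e : ℤˣ) : ℝ := if e = 1 then 1 / 2 else 1

/-- `θ(τ)` is the continuous determination of `arg h(a + iτ)` on the line `Re s = a` with
`θ(0) = 0`.  If `h(a) > 0`, the last condition says `h(a + iτ) = |h(a + iτ)| exp(iθ(τ))`;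
if `h(a) < 0`, it says the same for `-h`, which has the same zeros. -/
def IsPhaseFunction (a : ℝ) (h : ℂ → ℂ) (θ : ℝ → ℝ) : Prop :=
  Continuous θ ∧ θ 0 = 0 ∧
    ∀ τ : ℝ, h ((a : ℂ) + (τ : ℂ) * Complex.I) / h (a : ℂ) =
      (‖h ((a : ℂ) + (τ : ℂ) * Complex.I) / h (a : ℂ)‖ : ℂ) *
        Complex.exp ((θ τ : ℂ) * Complex.I)

/-- Two sets of real numbers are interlaced: they are disjoint, and strictly between two distinct
points of either one there is a point of the other.  (So between two consecutive points of one
there is exactly one point of the other.) -/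
def Interlaced (A B : Set ℝ) : Prop :=
  Disjoint A B ∧
    (∀ x ∈ A, ∀ y ∈ A, x < y → ∃ z ∈ B, x < z ∧ z < y) ∧
    (∀ x ∈ B, ∀ y ∈ B, x < y → ∃ z ∈ A, x < z ∧ z < y)

/-! Where `h s ≠ 0`, `f = h (1 ± F)`, so the zeros of `f` are the points with `F = ∓1`. On `Re s =
a` the reflection `s ↦ 2a - s` is complex conjugation, so `F(a + iτ) = exp(-2iθ(τ))`: zeros there
are the solutions of `θ/π - u ∈ ℤ` (`reflSum_eq_zero_iff`). The analytic core is that `θ' > 0` for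
large `|τ|`. `F` is unimodular on the line and small far to the right; a Phragmén–Lindelöf argument
(`halfStrip_norm_le_exp_neg`) turns this into `|F(s)| ≤ exp(-c (Re s - a))` high in a strip.
Differentiating across the boundary (`re_deriv_div_le_of_norm_le_exp`) gives `Re (F'/F) ≤ -c`, that
is, `θ' ≥ c/2`. Counting and interlacing then concern integer and half-integer values of an
eventually increasing function (`ncard_integer_values_asymptotic`, `interlaced_of_strictMonoOn`).
Since `F' ≠ 0` on the line, zeros there are simple; since `|F| < 1` to its right and `f(2a - s) =
±f(s)`, high zeros lie on the line. -/

/-! ### Counting integer values of a real function -/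

theorem ncard_intCast_image_Ico (m n : ℤ) :
    (((fun k : ℤ => (k : ℝ)) '' Set.Ico m n).ncard : ℤ) = max (n - m) 0 := by
  rw [Set.ncard_image_of_injective _ Int.cast_injective, ← Finset.coe_Ico,
    Set.ncard_coe_finset, Int.card_Ico, Int.toNat_eq_max]

/-- A continuous strictly increasing function takes integer values on `[S, T)` exactly
`⌈φ T⌉ - ⌈φ S⌉` times. -/
theorem ncard_integer_values_of_strictMonoOn {φ : ℝ → ℝ} (hc : Continuous φ) {S T : ℝ}
    (hmono : StrictMonoOn φ (Set.Ici S)) (hST : S ≤ T) :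
    (({τ | ∃ k : ℤ, φ τ = k} ∩ Set.Ico S T).ncard : ℤ) = ⌈φ T⌉ - ⌈φ S⌉ := by
  have himg : φ '' ({τ | ∃ k : ℤ, φ τ = k} ∩ Set.Ico S T) =
      (fun k : ℤ => (k : ℝ)) '' Set.Ico ⌈φ S⌉ ⌈φ T⌉ := by
    ext y
    constructor
    · rintro ⟨τ, ⟨⟨k, hk⟩, h1, h2⟩, rfl⟩
      refine ⟨k, ⟨?_, ?_⟩, hk.symm⟩
      · rw [Int.ceil_le, ← hk]
        exact hmono.monotoneOn Set.self_mem_Ici h1 h1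
      · rw [Int.lt_ceil, ← hk]
        exact hmono h1 (h1.trans h2.le) h2
    · rintro ⟨k, ⟨h1, h2⟩, rfl⟩
      rw [Int.ceil_le] at h1
      rw [Int.lt_ceil] at h2
      obtain ⟨τ, hτ, hk⟩ := intermediate_value_Ico hST hc.continuousOn ⟨h1, h2⟩
      exact ⟨τ, ⟨⟨k, hk⟩, hτ⟩, hk⟩
  have hinj : Set.InjOn φ ({τ | ∃ k : ℤ, φ τ = k} ∩ Set.Ico S T) :=
    hmono.injOn.mono fun τ hτ => hτ.2.1
  rw [← hinj.ncard_image, himg, ncard_intCast_image_Ico, max_eq_left]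
  have := Int.ceil_le_ceil (hmono.monotoneOn Set.self_mem_Ici hST hST)
  omega

/-- Starting below `0`, `φ` must cross each of `0, …, ⌈φ T⌉ - 1` before `T`. This makes the excess
`d` nonnegative. -/
theorem ceil_le_ncard_integer_values {φ : ℝ → ℝ} (hc : Continuous φ) (h0 : φ 0 < 0) {T : ℝ}
    (hT : 0 ≤ T) (hfin : ({τ | ∃ k : ℤ, φ τ = k} ∩ Set.Ioo 0 T).Finite) :
    ⌈φ T⌉ ≤ (({τ | ∃ k : ℤ, φ τ = k} ∩ Set.Ioo 0 T).ncard : ℤ) := by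
  have hsub : (fun k : ℤ => (k : ℝ)) '' Set.Ico 0 ⌈φ T⌉ ⊆
      φ '' ({τ | ∃ k : ℤ, φ τ = k} ∩ Set.Ioo 0 T) := by
    rintro _ ⟨k, ⟨h1, h2⟩, rfl⟩
    rw [Int.lt_ceil] at h2
    have h1' : φ 0 < k := h0.trans_le (by exact_mod_cast h1)
    obtain ⟨τ, hτ, hk⟩ := intermediate_value_Ioo hT hc.continuousOn ⟨h1', h2⟩
    exact ⟨τ, ⟨⟨k, hk⟩, hτ⟩, hk⟩
  have h1 := Set.ncard_le_ncard hsub (hfin.image φ)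
  have h2 := Set.ncard_image_le (f := φ) hfin
  have h3 := ncard_intCast_image_Ico 0 ⌈φ T⌉
  have h4 := le_max_left (⌈φ T⌉ - 0) 0
  omega

/-- Finiteness forbids plateaus at integer height, so a monotone `φ` takes each integer value at
most once. For the same reason the value `-1`, possible at `0`, is not taken again. -/
theorem ncard_integer_values_le_ceil {φ : ℝ → ℝ} (h0 : -1 ≤ φ 0)
    (hmono : MonotoneOn φ (Set.Ici 0))
    (hfin : ∀ T, ({τ | ∃ k : ℤ, φ τ = k} ∩ Set.Ioo 0 T).Finite) {T : ℝ} (hT : -1 < φ T) :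
    (({τ | ∃ k : ℤ, φ τ = k} ∩ Set.Ioo 0 T).ncard : ℤ) ≤ ⌈φ T⌉ := by
  have key : ∀ x y : ℝ, 0 ≤ x → x < y → ∀ k : ℤ, φ x = k → φ x < φ y := by
    intro x y hx hxy k hk
    have hy : 0 ≤ y := hx.trans hxy.le
    refine lt_of_le_of_ne (hmono hx hy hxy.le) fun heq => ?_
    refine (Set.Ioo_infinite hxy) ((hfin y).subset ?_)
    intro z hz
    have hz0 : 0 < z := hx.trans_lt hz.1
    refine ⟨⟨k, ?_⟩, hz0, hz.2⟩
    rw [← hk]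
    exact le_antisymm (heq ▸ hmono hz0.le hy hz.2.le) (hmono hx hz0.le hz.1.le)
  have hsub : φ '' ({τ | ∃ k : ℤ, φ τ = k} ∩ Set.Ioo 0 T) ⊆
      (fun k : ℤ => (k : ℝ)) '' Set.Ico 0 ⌈φ T⌉ := by
    rintro _ ⟨τ, ⟨⟨k, hk⟩, h1, h2⟩, rfl⟩
    refine ⟨k, ⟨?_, ?_⟩, hk.symm⟩
    · have h3 : φ 0 ≤ φ τ := hmono Set.self_mem_Ici h1.le h1.le
      have h4 : (-1 : ℝ) < k := by
        rw [← hk]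
        rcases h0.lt_or_eq with h | h
        · linarith
        · have := key 0 τ le_rfl h1 (-1) (by rw [← h]; norm_num)
          linarith
      have : (-1 : ℤ) < k := by exact_mod_cast h4
      omega
    · rw [Int.lt_ceil, ← hk]
      exact key τ T h1.le h2 k hk
  have hinj : Set.InjOn φ ({τ | ∃ k : ℤ, φ τ = k} ∩ Set.Ioo 0 T) := by
    rintro x ⟨⟨k, hk⟩, hx, -⟩ y ⟨⟨m, hm⟩, hy, -⟩ hxy
    rcases lt_trichotomy x y with h | h | h
    · exact absurd hxy (key x y hx.le h k hk).ne
    · exact h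
    · exact absurd hxy.symm (key y x hy.le h m hm).ne
  have h1 := Set.ncard_le_ncard hsub ((Set.finite_Ico _ _).image _)
  rw [hinj.ncard_image] at h1
  have h3 := ncard_intCast_image_Ico 0 ⌈φ T⌉
  have h4 : 0 ≤ ⌈φ T⌉ := by
    have : (-1 : ℤ) < ⌈φ T⌉ := by rw [Int.lt_ceil]; simpa using hT
    omega
  rw [max_eq_left (by omega)] at h3
  omega

/-- Beyond `S` the count and `⌈φ T⌉` grow by equal amounts, so their difference is frozen at its
value at `S`. -/
theorem ncard_integer_values_asymptotic {φ : ℝ → ℝ} (hc : Continuous φ) (h0 : -1 ≤ φ 0)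
    (h0' : φ 0 < 0) {S : ℝ} (hS : 0 < S) (hmono : StrictMonoOn φ (Set.Ici S))
    (hfin : ∀ T, ({τ | ∃ k : ℤ, φ τ = k} ∩ Set.Ioo 0 T).Finite) :
    (∃ C : ℝ, ∀ T : ℝ, 0 < T →
      |(({τ | ∃ k : ℤ, φ τ = k} ∩ Set.Ioo 0 T).ncard : ℝ) - φ T| ≤ C) ∧
    ∃ d : ℕ, (∀ T, S ≤ T →
      (({τ | ∃ k : ℤ, φ τ = k} ∩ Set.Ioo 0 T).ncard : ℤ) = ⌈φ T⌉ + d) ∧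
      (MonotoneOn φ (Set.Ici 0) → d = 0) := by
  set N : ℝ → ℕ := fun T => ({τ | ∃ k : ℤ, φ τ = k} ∩ Set.Ioo 0 T).ncard with hN
  obtain ⟨d, hd⟩ : ∃ d : ℕ, (N S : ℤ) = ⌈φ S⌉ + d := by
    have := ceil_le_ncard_integer_values hc h0' hS.le (hfin S)
    exact ⟨((N S : ℤ) - ⌈φ S⌉).toNat, by simp only [hN]; omega⟩
  have hform : ∀ T, S ≤ T → (N T : ℤ) = ⌈φ T⌉ + d := by
    intro T hT
    have hsplit : {τ | ∃ k : ℤ, φ τ = k} ∩ Set.Ioo 0 T =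
        ({τ | ∃ k : ℤ, φ τ = k} ∩ Set.Ioo 0 S) ∪ ({τ | ∃ k : ℤ, φ τ = k} ∩ Set.Ico S T) := by
      rw [← Set.inter_union_distrib_left, Set.Ioo_union_Ico_eq_Ioo hS hT]
    have hdisj : Disjoint ({τ | ∃ k : ℤ, φ τ = k} ∩ Set.Ioo 0 S)
        ({τ | ∃ k : ℤ, φ τ = k} ∩ Set.Ico S T) :=
      Set.disjoint_left.2 fun x hx hy => absurd hx.2.2 (not_lt.2 hy.2.1)
    have hfin2 : ({τ | ∃ k : ℤ, φ τ = k} ∩ Set.Ico S T).Finite :=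
      (hfin T).subset (by rw [hsplit]; exact Set.subset_union_right)
    have h1 := Set.ncard_union_eq hdisj (hfin S) hfin2
    rw [← hsplit] at h1
    have h2 := ncard_integer_values_of_strictMonoOn hc hmono hT
    simp only [hN] at hd ⊢
    omega
  refine ⟨?_, d, hform, fun hm => ?_⟩
  · obtain ⟨M, hM⟩ := isCompact_Icc.exists_bound_of_continuousOn (s := Set.Icc 0 S)
      hc.continuousOn
    refine ⟨d + 1 + (N S + M), fun T hT => ?_⟩
    have hM0 : 0 ≤ M := (norm_nonneg _).trans (hM 0 ⟨le_rfl, hS.le⟩)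
    have hNS : (0 : ℝ) ≤ N S := Nat.cast_nonneg _
    have hd0 : (0 : ℝ) ≤ d := Nat.cast_nonneg _
    change |(N T : ℝ) - φ T| ≤ _
    rcases le_total S T with hST | hST
    · have h1 : (N T : ℝ) = ⌈φ T⌉ + d := by exact_mod_cast hform T hST
      have h2 := Int.le_ceil (φ T)
      have h3 := Int.ceil_lt_add_one (φ T)
      rw [h1, abs_le]
      constructor <;> linarith
    · have h1 : (N T : ℝ) ≤ N S := by
        exact_mod_cast Set.ncard_le_ncard
          (Set.inter_subset_inter_right _ (Set.Ioo_subset_Ioo_right hST)) (hfin S)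
      have h2 := abs_le.1 (hM T ⟨hT.le, hST⟩)
      have h3 : (0 : ℝ) ≤ N T := Nat.cast_nonneg _
      rw [abs_le]
      constructor <;> linarith [h2.1, h2.2]
  -- Evaluating at `S + 1` rather than `S` guarantees a value strictly above `-1`.
  · have hlt : φ S < φ (S + 1) := hmono Set.self_mem_Ici (by simp) (by linarith)
    have h1 : φ 0 ≤ φ S := hm Set.self_mem_Ici hS.le hS.le
    have h2 := ncard_integer_values_le_ceil h0 hm hfin (T := S + 1) (by linarith)
    have h3 := hform (S + 1) (by linarith)
    simp only [hN] at h3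
    omega

/-! ### Phragmén–Lindelöf in a half-strip -/

open Complex in
/-- A Phragmén–Lindelöf principle in a half-strip: a function bounded by `1` on one side and by
`exp (-1)` on the other, and of subexponential growth along a sequence of cross-sections,
decays linearly in the exponent from the first side, high enough in the half-strip. -/
theorem halfStrip_norm_le_exp_neg {F : ℂ → ℂ} {a σ T : ℝ} (haσ : a < σ)
    (hF : ∀ s : ℂ, a ≤ s.re → s.re ≤ σ → T ≤ s.im → AnalyticAt ℂ F s)
    (hL : ∀ s : ℂ, s.re = a → T ≤ s.im → ‖F s‖ ≤ 1)
    (hR : ∀ s : ℂ, s.re = σ → T ≤ s.im → ‖F s‖ ≤ Real.exp (-1))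
    (hG : ∀ ε : ℝ, 0 < ε → ∃ t : ℕ → ℝ, Filter.Tendsto t Filter.atTop Filter.atTop ∧
      ∀ n : ℕ, ∀ s : ℂ, a ≤ s.re → s.re ≤ σ → s.im = t n → ‖F s‖ ≤ Real.exp (ε * ‖s‖)) :
    ∃ T' c : ℝ, 0 < c ∧ ∀ s : ℂ, a ≤ s.re → s.re ≤ σ → T' ≤ s.im →
      ‖F s‖ ≤ Real.exp (-c * (s.re - a)) := by
  -- The bottom bound must equal `1` at the corner, where the sine correction below vanishes. The
  -- mean value inequality from the corner gives `1 + C x ≤ exp (C x)`.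
  obtain ⟨C, hC0, hB⟩ : ∃ C : ℝ, 0 ≤ C ∧ ∀ s : ℂ, a ≤ s.re → s.re ≤ σ → s.im = T →
      ‖F s‖ ≤ Real.exp (C * (s.re - a)) := by
    set B : Set ℂ := Set.Icc a σ ×ℂ {T} with hBdef
    have hBc : IsCompact B := isCompact_Icc.reProdIm isCompact_singleton
    have hBconv : Convex ℝ B := ((convex_Icc a σ).linear_preimage Complex.reLm).inter
      ((convex_singleton T).linear_preimage Complex.imLm)
    have hFB : ∀ s ∈ B, AnalyticAt ℂ F s := fun s hs => hF s hs.1.1 hs.1.2 (le_of_eq hs.2.symm)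
    obtain ⟨C, hC⟩ := hBc.exists_bound_of_continuousOn (f := deriv F)
      fun s hs => (hFB s hs).deriv.continuousAt.continuousWithinAt
    have hmem : (⟨a, T⟩ : ℂ) ∈ B := ⟨⟨le_rfl, haσ.le⟩, rfl⟩
    have hC0 : 0 ≤ C := (norm_nonneg _).trans (hC _ hmem)
    refine ⟨C, hC0, fun s h1 h2 h3 => ?_⟩
    have h4 := hBconv.norm_image_sub_le_of_norm_deriv_le
      (fun x hx => (hFB x hx).differentiableAt) hC hmem (y := s) ⟨⟨h1, h2⟩, h3⟩
    have h5 : s - ⟨a, T⟩ = ((s.re - a : ℝ) : ℂ) := by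
      apply Complex.ext <;> simp [h3]
    rw [h5, Complex.norm_real, Real.norm_of_nonneg (by linarith)] at h4
    have h6 := hL ⟨a, T⟩ rfl le_rfl
    have h7 := norm_le_norm_sub_add (F s) (F ⟨a, T⟩)
    linarith [Real.add_one_le_exp (C * (s.re - a))]
  set L : ℝ := σ - a with hLdef
  have hL0 : 0 < L := sub_pos.2 haσ
  set w : ℝ := Real.pi / (2 * L) with hw
  have hw0 : 0 < w := by positivity
  set K : ℝ := 1 + C * L with hK
  have hK0 : 0 < K := by positivity
  have hwL : w * L = Real.pi / 2 := by rw [hw]; field_simp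
  have hsin0 : ∀ x : ℝ, 0 ≤ x → x ≤ L → 0 ≤ Real.sin (w * x) := fun x h1 h2 =>
    Real.sin_nonneg_of_nonneg_of_le_pi (by positivity)
      (by nlinarith [Real.pi_pos, mul_le_mul_of_nonneg_left h2 hw0.le])
  have hsin1 : ∀ x : ℝ, 0 ≤ x → x ≤ L → x / L ≤ Real.sin (w * x) := fun x h1 h2 => by
    have := Real.mul_le_sin (x := w * x) (by positivity)
      (by nlinarith [mul_le_mul_of_nonneg_left h2 hw0.le])
    refine le_of_eq_of_le ?_ this
    rw [hw]; field_simp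
  -- With `x = Re s - a` and `y = Im s - T`, the real part is `x/L - K exp(-w y) sin(w x) - ε y`.
  -- The first term matches `exp (-1)` on the right edge; the second beats the bottom bound, since
  -- `sin(w x) ≥ x/L` and `K/L = 1/L + C`; the third absorbs the growth at the top.
  set E : ℝ → ℂ → ℂ := fun ε s => (s - a) / L + I * K * exp (I * w * (s - a - T * I)) +
    I * ε * (s - T * I) with hE
  have hEre : ∀ ε s, (E ε s).re = (s.re - a) / L -
      K * (Real.exp (-(w * (s.im - T))) * Real.sin (w * (s.re - a))) - ε * (s.im - T) := by
    intro ε s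
    have h1 : (I * w * (s - a - T * I)) = ((-(w * (s.im - T)) : ℝ) : ℂ) +
        ((w * (s.re - a) : ℝ) : ℂ) * I := by
      apply Complex.ext <;> simp
    simp only [hE]
    rw [h1, Complex.exp_add, Complex.exp_mul_I, ← Complex.ofReal_exp, ← Complex.ofReal_cos,
      ← Complex.ofReal_sin]
    have h2 : ((s - a) / L).re = (s.re - a) / L := by
      rw [Complex.div_ofReal_re]; simp
    rw [Complex.add_re, Complex.add_re, h2]
    simp [-Complex.ofReal_exp, -Complex.ofReal_cos, -Complex.ofReal_sin, -Complex.ofReal_neg, -Complex.ofReal_mul, -Complex.ofReal_sub]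
    ring
  have hmain : ∀ s : ℂ, a ≤ s.re → s.re ≤ σ → T ≤ s.im → ∀ ε : ℝ, 0 < ε →
      ‖F s * exp (E ε s)‖ ≤ 1 := by
    intro s hs1 hs2 hs3 ε hε
    obtain ⟨t, ht, hGt⟩ := hG (ε / 2) (half_pos hε)
    set M : ℝ := |a| + |σ| + |T| with hM
    -- High enough that `1 + (ε/2)‖z‖ ≤ ε y` on the top edge, where `‖z‖ ≤ M + y`.
    obtain ⟨n, hn⟩ := (ht.eventually_gt_atTop (max s.im (T + 2 / ε * (1 + ε / 2 * M)))).exists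
    have hn1 : s.im < t n := (le_max_left _ _).trans_lt hn
    have hn2 : T + 2 / ε * (1 + ε / 2 * M) < t n := (le_max_right _ _).trans_lt hn
    have hTt : T < t n := hs3.trans_lt hn1
    have hcl : closure (Set.Ioo a σ ×ℂ Set.Ioo T (t n)) = Set.Icc a σ ×ℂ Set.Icc T (t n) := by
      rw [closure_reProdIm, closure_Ioo haσ.ne, closure_Ioo hTt.ne]
    have hexp : ∀ z : ℂ, ∀ b : ℝ, ‖F z‖ ≤ Real.exp b → b + (E ε z).re ≤ 0 →
        ‖F z * exp (E ε z)‖ ≤ 1 := by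
      intro z b hb h1
      rw [norm_mul, Complex.norm_exp]
      calc ‖F z‖ * Real.exp (E ε z).re ≤ Real.exp b * Real.exp (E ε z).re := by gcongr
        _ = Real.exp (b + (E ε z).re) := (Real.exp_add _ _).symm
        _ ≤ 1 := Real.exp_le_one_iff.2 h1
    refine Complex.norm_le_of_forall_mem_frontier_norm_le (f := fun z => F z * exp (E ε z))
      (U := Set.Ioo a σ ×ℂ Set.Ioo T (t n)) (z := s) ?_ ?_ ?_ ?_
    · exact (Metric.isBounded_Ioo a σ).reProdIm (Metric.isBounded_Ioo T (t n))
    · have hd : DifferentiableOn ℂ (fun z => F z * exp (E ε z))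
          (closure (Set.Ioo a σ ×ℂ Set.Ioo T (t n))) := by
        rw [hcl]
        intro z hz
        have h1 := (hF z hz.1.1 hz.1.2 hz.2.1).differentiableAt
        have h2 : DifferentiableAt ℂ (fun z => exp (E ε z)) z := by
          simp only [hE]
          fun_prop
        exact (h1.mul h2).differentiableWithinAt
      exact hd.diffContOnCl
    · intro z hz
      rw [frontier_reProdIm, closure_Ioo haσ.ne, closure_Ioo hTt.ne, frontier_Ioo haσ,
        frontier_Ioo hTt] at hz
      have hz1 : z.re ∈ Set.Icc a σ := by
        rcases hz with hz | hz
        · exact hz.1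
        · rcases hz.1 with h | h <;> rw [h] <;> simp [haσ.le]
      have hz2 : z.im ∈ Set.Icc T (t n) := by
        rcases hz with hz | hz
        · rcases hz.2 with h | h <;> rw [h] <;> simp [hTt.le]
        · exact hz.2
      have hx0 : 0 ≤ z.re - a := sub_nonneg.2 hz1.1
      have hxL : z.re - a ≤ L := by linarith [hz1.2]
      have hxL1 : (z.re - a) / L ≤ 1 := (div_le_one hL0).2 hxL
      have hy0 : 0 ≤ ε * (z.im - T) := mul_nonneg hε.le (sub_nonneg.2 hz2.1)
      have hS0 : 0 ≤ K * (Real.exp (-(w * (z.im - T))) * Real.sin (w * (z.re - a))) :=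
        mul_nonneg hK0.le (mul_nonneg (Real.exp_pos _).le (hsin0 _ hx0 hxL))
      have hR1 := hEre ε z
      rcases hz with hz | hz
      · rcases hz.2 with h | h
        · refine hexp z _ (hB z hz1.1 hz1.2 h) ?_
          rw [hR1, h]
          have h3 := mul_le_mul_of_nonneg_left (hsin1 _ hx0 hxL) hK0.le
          have h4 : K * ((z.re - a) / L) = (z.re - a) / L + C * (z.re - a) := by
            rw [hK]; field_simp
          simp only [sub_self, mul_zero, neg_zero, Real.exp_zero, one_mul, sub_zero]
          linarith
        · refine hexp z _ (hGt n z hz1.1 hz1.2 h) ?_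
          have h3 : ‖z‖ ≤ M + (z.im - T) := by
            have h4 := Complex.norm_le_abs_re_add_abs_im z
            have h5 : |z.re| ≤ |a| + |σ| := by
              rw [abs_le]
              constructor
              · linarith [neg_abs_le a, abs_nonneg σ, hz1.1]
              · linarith [le_abs_self σ, abs_nonneg a, hz1.2]
            have h6 : |z.im| ≤ |T| + (z.im - T) := by
              have := abs_add_le T (z.im - T)
              rw [abs_of_nonneg (sub_nonneg.2 hz2.1)] at this
              simpa using this
            linarith
          have h4 := mul_le_mul_of_nonneg_left h3 (half_pos hε).le
          have h5 : 1 + ε / 2 * M < ε / 2 * (z.im - T) := by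
            have : 2 / ε * (1 + ε / 2 * M) < z.im - T := by rw [h]; linarith
            have := mul_lt_mul_of_pos_left this (half_pos hε)
            rwa [← mul_assoc, div_mul_div_comm, mul_comm 2 ε, div_self (by positivity),
              one_mul] at this
          rw [hR1]
          linarith
      · rcases hz.1 with h | h
        · refine hexp z 0 (by simpa using hL z h hz2.1) ?_
          rw [hR1, h] at *
          simp at *
          linarith
        · refine hexp z _ (hR z h hz2.1) ?_
          rw [hR1]
          linarith
    · rw [hcl]
      exact ⟨⟨hs1, hs2⟩, hs3, hn1.le⟩
  have hlim : ∀ s : ℂ, a ≤ s.re → s.re ≤ σ → T ≤ s.im → ‖F s * exp (E 0 s)‖ ≤ 1 := by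
    intro s h1 h2 h3
    have hcont : Continuous fun ε : ℝ => ‖F s * exp (E ε s)‖ := by
      simp only [hE]
      fun_prop
    refine le_of_tendsto (hcont.continuousWithinAt (s := Set.Ioi 0) (x := 0)).tendsto ?_
    filter_upwards [self_mem_nhdsWithin] with ε hε using hmain s h1 h2 h3 ε hε
  have hdecay : Filter.Tendsto (fun y : ℝ => K * w * Real.exp (-(w * (y - T))))
      Filter.atTop (nhds 0) := by
    rw [← mul_zero (K * w)]
    refine Filter.Tendsto.const_mul _ (Real.tendsto_exp_neg_atTop_nhds_zero.comp ?_)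
    exact Filter.Tendsto.const_mul_atTop hw0 (Filter.tendsto_atTop_add_const_right _ _ Filter.tendsto_id)
  have hev : ∀ᶠ y in Filter.atTop, K * w * Real.exp (-(w * (y - T))) < 1 / (2 * L) :=
    hdecay.eventually_lt_const (by positivity)
  obtain ⟨T', hT'⟩ := Filter.eventually_atTop.1 hev
  -- The rate is half of `1/L`: the sine term is at most `K w exp(-w y) x`, which costs at most the
  -- other half once `y` is large.
  refine ⟨max T T', 1 / (2 * L), by positivity, fun s h1 h2 h3 => ?_⟩
  have h4 := hlim s h1 h2 ((le_max_left _ _).trans h3)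
  have h5 := hT' s.im ((le_max_right _ _).trans h3)
  rw [norm_mul, Complex.norm_exp, ← le_div_iff₀ (Real.exp_pos _), one_div, ← Real.exp_neg] at h4
  refine h4.trans (Real.exp_le_exp.2 ?_)
  rw [hEre]
  have hx0 : 0 ≤ s.re - a := sub_nonneg.2 h1
  have h6 : Real.sin (w * (s.re - a)) ≤ w * (s.re - a) := Real.sin_le (by positivity)
  have h7 := mul_le_mul_of_nonneg_left h6
    (mul_nonneg hK0.le (Real.exp_pos (-(w * (s.im - T)))).le)
  have h8 := mul_le_mul_of_nonneg_right h5.le hx0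
  have h9 : (s.re - a) / L = 2 * (1 / (2 * L) * (s.re - a)) := by field_simp
  rw [h9]
  linarith

/-! ### Conjugation symmetry on the line -/

open ComplexConjugate in
theorem analyticAt_conj_conj {f : ℂ → ℂ} {s : ℂ} (hf : AnalyticAt ℂ f (conj s)) :
    AnalyticAt ℂ (fun z => conj (f (conj z))) s := by
  rw [Complex.analyticAt_iff_eventually_differentiableAt] at hf ⊢
  filter_upwards [(Complex.continuous_conj.tendsto s).eventually hf] with z hz
  simpa [Function.comp_def] using hz.conj_conj

theorem isPreconnected_re_eq (a : ℝ) : IsPreconnected {s : ℂ | s.re = a} :=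
  ((convex_singleton a).linear_preimage Complex.reLm).isPreconnected

open ComplexConjugate in
-- The identity theorem is applied on the line alone, where both sides are analytic; they agree at
-- real points accumulating at `a`. Poles elsewhere do not matter.
theorem apply_conj_of_re_eq {a : ℝ} {h : ℂ → ℂ} (h_real : ∀ x : ℝ, (h (x : ℂ)).im = 0)
    (h_line : ∀ s : ℂ, s.re = a → AnalyticAt ℂ h s) {s : ℂ} (hs : s.re = a) :
    h (conj s) = conj (h s) := by
  have h1 : AnalyticOnNhd ℂ h {s : ℂ | s.re = a} := h_line
  have h2 : AnalyticOnNhd ℂ (fun z => conj (h (conj z))) {s : ℂ | s.re = a} :=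
    fun z hz => analyticAt_conj_conj (h_line _ (by simpa using hz))
  have hfreq : ∃ᶠ z in nhdsWithin (a : ℂ) {(a : ℂ)}ᶜ, h z = conj (h (conj z)) := by
    have ht : Filter.Tendsto (fun x : ℝ => (x : ℂ)) (nhdsWithin a {a}ᶜ)
        (nhdsWithin (a : ℂ) {(a : ℂ)}ᶜ) :=
      tendsto_nhdsWithin_of_tendsto_nhds_of_eventually_within _
        (Complex.continuous_ofReal.continuousWithinAt.tendsto) (by
          filter_upwards [self_mem_nhdsWithin] with x hx
          simpa using hx)
    refine ht.frequently (Filter.Frequently.of_forall fun x => ?_)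
    rw [Complex.conj_ofReal, Complex.conj_eq_iff_im.2 (h_real x)]
  have h3 := h1.eqOn_of_preconnected_of_frequently_eq h2 (isPreconnected_re_eq a)
    (Complex.ofReal_re a) hfreq hs
  simp [h3]

/-! ### Boundary derivatives and the phase -/

/-- If a function stays below its value at `x` on the right of `x`, its derivative at `x` is
nonpositive. -/
theorem HasDerivAt.nonpos_of_le_right {g : ℝ → ℝ} {g' x L : ℝ} (hg : HasDerivAt g g' x)
    (hL : 0 < L) (hle : ∀ t, x < t → t < x + L → g t ≤ g x) : g' ≤ 0 := by
  refine le_of_tendsto ((hasDerivWithinAt_iff_tendsto_slope' Set.self_notMem_Ioi).1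
    (hg.hasDerivWithinAt (s := Set.Ioi x))) ?_
  filter_upwards [Ioo_mem_nhdsGT (lt_add_of_pos_right x hL)] with t ht
  rw [slope_def_field]
  exact div_nonpos_of_nonpos_of_nonneg (sub_nonpos.2 (hle t ht.1 ht.2)) (sub_nonneg.2 ht.1.le)

/-- A boundary-derivative estimate of Hopf type. -/
theorem re_deriv_div_le_of_norm_le_exp {F : ℂ → ℂ} {F' s : ℂ} {c L : ℝ} (hF : HasDerivAt F F' s)
    (hs : ‖F s‖ = 1) (hL : 0 < L)
    (hle : ∀ t : ℝ, 0 < t → t < L → ‖F (s + t)‖ ≤ Real.exp (-c * t)) :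
    (F' / F s).re ≤ -c := by
  have h1 : HasDerivAt (fun t : ℝ => F (s + t)) F' 0 := by
    have h2 : HasDerivAt (fun t : ℝ => s + (t : ℂ)) 1 0 :=
      (Complex.ofRealCLM.hasDerivAt (x := (0 : ℝ))).const_add s
    have h3 : HasDerivAt F F' (s + ((0 : ℝ) : ℂ)) := by simpa using hF
    simpa [Function.comp_def] using HasDerivAt.comp (h₂ := F) (0 : ℝ) h3 h2
  have h2 := h1.norm_sq
  have h3 : HasDerivAt (fun t : ℝ => Real.exp (-(2 * c) * t)) (-(2 * c)) 0 := by
    simpa using ((hasDerivAt_id (0 : ℝ)).const_mul (-(2 * c))).exp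
  -- The function `‖F(s + t)‖² - exp(-2ct)` vanishes at `t = 0` and is nonpositive just to the
  -- right.
  have h4 := (h2.sub h3).nonpos_of_le_right hL (fun t ht1 ht2 => by
    have h5 := hle t ht1 (by simpa using ht2)
    have h6 : ‖F (s + t)‖ ^ 2 ≤ Real.exp (-c * t) ^ 2 := by gcongr
    rw [← Real.exp_nat_mul] at h6
    have h7 : ((2 : ℕ) : ℝ) * (-c * t) = -(2 * c) * t := by push_cast; ring
    rw [h7] at h6
    simp only [Pi.sub_apply, Complex.ofReal_zero, add_zero, hs, mul_zero,
      Real.exp_zero]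
    linarith)
  have h5 : (F' / F s).re = (F' * (starRingEnd ℂ) (F s)).re := by
    rw [div_eq_mul_inv, Complex.inv_def, Complex.normSq_eq_norm_sq, hs]
    simp
  rw [h5]
  simp only [Complex.ofReal_zero, add_zero, Complex.inner] at h4
  linarith

/-- A continuous determination of the phase of a differentiable function is differentiable. -/
theorem hasDerivAt_of_hasDerivAt_cexp {θ : ℝ → ℝ} (hθ : Continuous θ) {b τ : ℝ} (hb : b ≠ 0) {D : ℂ}
    (hD : HasDerivAt (fun t : ℝ => Complex.exp (((b * θ t : ℝ) : ℂ) * Complex.I)) D τ) :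
    HasDerivAt θ ((D / Complex.exp (((b * θ τ : ℝ) : ℂ) * Complex.I)).im / b) τ := by
  set q : ℂ := Complex.exp (((b * θ τ : ℝ) : ℂ) * Complex.I) with hq
  have hq0 : q ≠ 0 := Complex.exp_ne_zero _
  have h1 := hD.div_const q
  -- Dividing by the value at `τ` moves the base point to `1`, so the principal logarithm recovers
  -- the phase increment near `τ`.
  have h2 := h1.clog_real (by rw [← hq, div_self hq0]; exact Complex.one_mem_slitPlane)
  rw [← hq, div_self hq0, div_one] at h2
  have h3 := (Complex.imCLM.hasFDerivAt.comp_hasDerivAt τ h2).div_const b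
  have h4 := h3.add_const (θ τ)
  refine h4.congr_of_eventuallyEq ?_
  have hcont : Continuous fun t => b * (θ t - θ τ) := by fun_prop
  have hev : ∀ᶠ t in nhds τ, b * (θ t - θ τ) ∈ Set.Ioo (-Real.pi) Real.pi :=
    hcont.continuousAt.eventually_mem (by
      simpa using Ioo_mem_nhds (neg_lt_zero.2 Real.pi_pos) Real.pi_pos)
  filter_upwards [hev] with t ht
  have h5 : Complex.exp (((b * θ t : ℝ) : ℂ) * Complex.I) / q =
      Complex.exp (((b * (θ t - θ τ) : ℝ) : ℂ) * Complex.I) := by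
    rw [hq, ← Complex.exp_sub]
    congr 1
    push_cast; ring
  have him : ((((b * (θ t - θ τ) : ℝ) : ℂ) * Complex.I)).im = b * (θ t - θ τ) := by
    rw [Complex.im_ofReal_mul, Complex.I_im, mul_one]
  simp only [Function.comp_apply, Complex.imCLM_apply]
  rw [h5, Complex.log_exp (by rw [him]; exact ht.1) (by rw [him]; exact ht.2.le), him]
  field_simp
  ring

/-! ### Interlacing of integer and half-integer levels -/

theorem interlaced_of_strictMonoOn {φ : ℝ → ℝ} (hc : Continuous φ) {I : Set ℝ}
    (hmono : StrictMonoOn φ I) (hI : I.OrdConnected) :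
    Interlaced ({τ | ∃ k : ℤ, φ τ - phaseShift 1 = k} ∩ I)
      ({τ | ∃ k : ℤ, φ τ - phaseShift (-1) = k} ∩ I) := by
  have hp : phaseShift 1 = 1 / 2 := by simp [phaseShift]
  have hn : phaseShift (-1) = 1 := by simp [phaseShift]
  have key : ∀ x ∈ I, ∀ y ∈ I, x < y → ∀ v ∈ Set.Ioo (φ x) (φ y), ∃ z ∈ I, φ z = v ∧ x < z ∧ z < y := by
    intro x hx y hy hxy v hv
    obtain ⟨z, hz, hzv⟩ := intermediate_value_Ioo hxy.le hc.continuousOn hv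
    exact ⟨z, hI.out hx hy ⟨hz.1.le, hz.2.le⟩, hzv, hz.1, hz.2⟩
  rw [hp, hn]
  refine ⟨?_, ?_, ?_⟩
  · refine Set.disjoint_left.2 ?_
    rintro x ⟨⟨k, hk⟩, -⟩ ⟨⟨m, hm⟩, -⟩
    have h1 : (2 * k + 1 : ℝ) = 2 * m + 2 := by linarith
    have h2 : 2 * k + 1 = 2 * m + 2 := by exact_mod_cast h1
    omega
  · rintro x ⟨⟨k, hk⟩, hx⟩ y ⟨⟨m, hm⟩, hy⟩ hxy
    have h1 := hmono hx hy hxy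
    have h2 : k < m := by
      have : (k : ℝ) < m := by linarith
      exact_mod_cast this
    have h3 : (k : ℝ) + 1 ≤ m := by exact_mod_cast h2
    obtain ⟨z, hzI, hz, hxz, hzy⟩ := key x hx y hy hxy (k + 1) ⟨by linarith, by linarith⟩
    exact ⟨z, ⟨⟨k, by rw [hz]; ring⟩, hzI⟩, hxz, hzy⟩
  · rintro x ⟨⟨k, hk⟩, hx⟩ y ⟨⟨m, hm⟩, hy⟩ hxy
    have h1 := hmono hx hy hxy
    have h2 : k < m := by
      have : (k : ℝ) < m := by linarith
      exact_mod_cast this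
    have h3 : (k : ℝ) + 1 ≤ m := by exact_mod_cast h2
    obtain ⟨z, hzI, hz, hxz, hzy⟩ := key x hx y hy hxy (k + 1 + 1 / 2) ⟨by linarith, by linarith⟩
    exact ⟨z, ⟨⟨k + 1, by rw [hz]; push_cast; ring⟩, hzI⟩, hxz, hzy⟩

/-! ### Zeros of the reflected sum and values of the quotient -/

theorem AnalyticAt.mem_zerosOf_iff {f : ℂ → ℂ} {s : ℂ} (hf : AnalyticAt ℂ f s) :
    s ∈ zerosOf f ↔ f s = 0 := by
  have h1 := hf.meromorphicNFAt.meromorphicOrderAt_nonneg_iff_analyticAt.2 hf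
  have h2 := hf.meromorphicNFAt.meromorphicOrderAt_eq_zero_iff
  rw [zerosOf, Set.mem_ofPred_eq, lt_iff_le_and_ne, and_iff_right h1, ne_comm, Ne, h2, not_not]

theorem exists_forall_analyticAt_ne_zero {a : ℝ} {h : ℂ → ℂ}
    (h_mero : MeromorphicNFOn h Set.univ) (h_poles : (polesOf h).Finite)
    (h_zeros : {s : ℂ | s ∈ zerosOf h ∧ a < s.re}.Finite)
    (h_line : ∀ s : ℂ, s.re = a → AnalyticAt ℂ h s ∧ h s ≠ 0) :
    ∃ T : ℝ, 0 < T ∧ ∀ s : ℂ, a ≤ s.re → T ≤ |s.im| →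
      AnalyticAt ℂ h s ∧ h s ≠ 0 ∧ AnalyticAt ℂ h (2 * (a : ℂ) - s) := by
  obtain ⟨M, hM⟩ := ((h_poles.union h_zeros).image fun s : ℂ => |s.im|).bddAbove
  refine ⟨max M 0 + 1, by positivity, fun s hs hT => ?_⟩
  have hMT : M < |s.im| := by linarith [le_max_left M 0]
  have han : ∀ z : ℂ, |z.im| = |s.im| → AnalyticAt ℂ h z := by
    intro z hz
    rw [← (h_mero (Set.mem_univ z)).meromorphicOrderAt_nonneg_iff_analyticAt]
    by_contra hneg
    have := hM ⟨z, Or.inl (not_le.1 hneg), rfl⟩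
    simp only [hz] at this
    linarith
  have h1 := han s rfl
  refine ⟨h1, ?_, han _ (by simp)⟩
  rcases hs.eq_or_lt with hs | hs
  · exact (h_line s hs.symm).2
  · intro h0
    have := hM ⟨s, Or.inr ⟨h1.mem_zerosOf_iff.2 h0, hs⟩, rfl⟩
    simp only at this
    linarith

theorem analyticAt_reflQuot {a : ℝ} {h : ℂ → ℂ} {s : ℂ} (h1 : AnalyticAt ℂ h s) (h0 : h s ≠ 0)
    (h2 : AnalyticAt ℂ h (2 * (a : ℂ) - s)) : AnalyticAt ℂ (reflQuot a h) s :=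
  (AnalyticAt.comp (g := h) (f := fun z => 2 * (a : ℂ) - z) h2 (by fun_prop)).fun_div h1 h0

theorem analyticAt_reflSum {a : ℝ} {h : ℂ → ℂ} {s : ℂ} (e : ℤˣ) (h1 : AnalyticAt ℂ h s)
    (h2 : AnalyticAt ℂ h (2 * (a : ℂ) - s)) : AnalyticAt ℂ (reflSum a h e) s :=
  h1.fun_add (analyticAt_const.fun_mul
    (AnalyticAt.comp (g := h) (f := fun z => 2 * (a : ℂ) - z) h2 (by fun_prop)))

theorem reflSum_eq_mul {a : ℝ} {h : ℂ → ℂ} {s : ℂ} (e : ℤˣ) (h0 : h s ≠ 0) :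
    reflSum a h e s = h s * (1 + ((e : ℤ) : ℂ) * reflQuot a h s) := by
  rw [reflSum, reflQuot]
  field_simp

theorem reflSum_reflect (a : ℝ) (h : ℂ → ℂ) (e : ℤˣ) (s : ℂ) :
    reflSum a h e (2 * (a : ℂ) - s) = ((e : ℤ) : ℂ) * reflSum a h e s := by
  have he : ((e : ℤ) : ℂ) * ((e : ℤ) : ℂ) = 1 := by
    rcases Int.units_eq_one_or e with rfl | rfl <;> simp
  simp only [reflSum, sub_sub_cancel]
  linear_combination (-h (2 * (a : ℂ) - s)) * he

open ComplexConjugate in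
theorem two_mul_sub_of_re_eq {a : ℝ} {s : ℂ} (hs : s.re = a) : 2 * (a : ℂ) - s = conj s := by
  apply Complex.ext
  · simp [hs]; ring
  · simp

theorem norm_reflQuot_of_re_eq {a : ℝ} {h : ℂ → ℂ} (h_real : ∀ x : ℝ, (h (x : ℂ)).im = 0)
    (h_line : ∀ s : ℂ, s.re = a → AnalyticAt ℂ h s ∧ h s ≠ 0) {s : ℂ} (hs : s.re = a) :
    ‖reflQuot a h s‖ = 1 := by
  rw [reflQuot, two_mul_sub_of_re_eq hs, apply_conj_of_re_eq h_real (fun z hz => (h_line z hz).1) hs,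
    norm_div, RCLike.norm_conj, div_self (norm_ne_zero_iff.2 (h_line s hs).2)]

/-- Here `F = conj h / h`; the modulus and the real factor `h a` cancel, whatever its sign. -/
theorem reflQuot_eq_cexp {a : ℝ} {h : ℂ → ℂ} (h_real : ∀ x : ℝ, (h (x : ℂ)).im = 0)
    (h_line : ∀ s : ℂ, s.re = a → AnalyticAt ℂ h s ∧ h s ≠ 0) {θ : ℝ → ℝ}
    (hθ : IsPhaseFunction a h θ) (τ : ℝ) :
    reflQuot a h ((a : ℂ) + (τ : ℂ) * Complex.I) =
      Complex.exp (((-2 * θ τ : ℝ) : ℂ) * Complex.I) := by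
  set s : ℂ := (a : ℂ) + (τ : ℂ) * Complex.I with hs
  have hre : s.re = a := by simp [hs]
  have h0 := (h_line s hre).2
  have ha := (h_line (a : ℂ) (Complex.ofReal_re a)).2
  have hphase := hθ.2.2 τ
  rw [← hs, div_eq_iff ha] at hphase
  set r : ℝ := ‖h s / h (a : ℂ)‖ with hr
  have hr0 : (r : ℂ) ≠ 0 := by
    rw [Complex.ofReal_ne_zero, hr]
    exact norm_ne_zero_iff.2 (div_ne_zero h0 ha)
  rw [reflQuot, two_mul_sub_of_re_eq hre,
    apply_conj_of_re_eq h_real (fun z hz => (h_line z hz).1) hre, div_eq_iff h0, hphase]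
  simp only [map_mul, Complex.conj_ofReal, ← Complex.exp_conj, Complex.conj_I,
    Complex.conj_eq_iff_im.2 (h_real a)]
  have h2 : Complex.exp ((θ τ : ℂ) * -Complex.I) =
      Complex.exp (((-2 * θ τ : ℝ) : ℂ) * Complex.I) * Complex.exp ((θ τ : ℂ) * Complex.I) := by
    rw [← Complex.exp_add]
    congr 1
    push_cast; ring
  rw [h2]
  ring

/-- For the minus sign any integer shift describes the same zeros; `1` puts the zero at `τ = 0` at
level `-1`, below the levels to be counted. -/
theorem reflSum_eq_zero_iff {a : ℝ} {h : ℂ → ℂ} (h_real : ∀ x : ℝ, (h (x : ℂ)).im = 0)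
    (h_line : ∀ s : ℂ, s.re = a → AnalyticAt ℂ h s ∧ h s ≠ 0) {θ : ℝ → ℝ}
    (hθ : IsPhaseFunction a h θ) (e : ℤˣ) (τ : ℝ) :
    reflSum a h e ((a : ℂ) + (τ : ℂ) * Complex.I) = 0 ↔
      ∃ k : ℤ, θ τ / Real.pi - phaseShift e = k := by
  have h0 := (h_line ((a : ℂ) + (τ : ℂ) * Complex.I) (by simp)).2
  rw [reflSum_eq_mul e h0, mul_eq_zero, or_iff_right h0, reflQuot_eq_cexp h_real h_line hθ]
  have hpi := Real.pi_ne_zero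
  have haux : ∀ x y : ℝ, Complex.exp ((x : ℂ) * Complex.I) = Complex.exp ((y : ℂ) * Complex.I) ↔
      ∃ n : ℤ, x = y + n * (2 * Real.pi) := by
    intro x y
    rw [Complex.exp_eq_exp_iff_exists_int]
    refine exists_congr fun n => ?_
    have h3 : (y : ℂ) * Complex.I + n * (2 * Real.pi * Complex.I) =
        ((y + n * (2 * Real.pi) : ℝ) : ℂ) * Complex.I := by push_cast; ring
    rw [h3, mul_left_inj' Complex.I_ne_zero, Complex.ofReal_inj]
  rcases Int.units_eq_one_or e with rfl | rfl
  · have h1 : (1 + (((1 : ℤˣ) : ℤ) : ℂ) * Complex.exp (((-2 * θ τ : ℝ) : ℂ) * Complex.I) = 0) ↔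
        Complex.exp (((-2 * θ τ : ℝ) : ℂ) * Complex.I) =
          Complex.exp (((Real.pi : ℝ) : ℂ) * Complex.I) := by
      rw [Complex.exp_pi_mul_I, Units.val_one, Int.cast_one, one_mul, add_comm,
        add_eq_zero_iff_eq_neg]
    rw [h1, haux]
    simp only [phaseShift, if_true]
    constructor
    · rintro ⟨n, hn⟩
      refine ⟨-n - 1, ?_⟩
      have : θ τ = -(Real.pi + n * (2 * Real.pi)) / 2 := by linarith
      rw [this]; push_cast; field_simp; ring
    · rintro ⟨k, hk⟩
      refine ⟨-k - 1, ?_⟩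
      have : θ τ = (k + 1 / 2) * Real.pi := by
        rw [← hk]; field_simp; ring
      rw [this]; push_cast; ring
  · have h1 : (1 + (((-1 : ℤˣ) : ℤ) : ℂ) * Complex.exp (((-2 * θ τ : ℝ) : ℂ) * Complex.I) = 0) ↔
        Complex.exp (((-2 * θ τ : ℝ) : ℂ) * Complex.I) =
          Complex.exp (((0 : ℝ) : ℂ) * Complex.I) := by
      simp only [Units.val_neg, Units.val_one, Int.cast_neg, Int.cast_one, Complex.ofReal_zero,
        zero_mul, Complex.exp_zero]
      rw [neg_one_mul, ← sub_eq_add_neg, sub_eq_zero, eq_comm]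
    rw [h1, haux]
    have hn : phaseShift (-1) = 1 := by simp [phaseShift]
    rw [hn]
    constructor
    · rintro ⟨n, hn⟩
      refine ⟨-n - 1, ?_⟩
      have : θ τ = -(n * (2 * Real.pi)) / 2 := by linarith
      rw [this]; push_cast; field_simp
    · rintro ⟨k, hk⟩
      refine ⟨-k - 1, ?_⟩
      have : θ τ = (k + 1) * Real.pi := by
        rw [← hk]; field_simp; ring
      rw [this]; push_cast; ring

/-! ### Exponential decay of the quotient off the line -/

open ComplexConjugate in
theorem exists_norm_reflQuot_le_exp {a : ℝ} {h : ℂ → ℂ}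
    (h_mero : MeromorphicNFOn h Set.univ)
    (h_real : ∀ x : ℝ, (h (x : ℂ)).im = 0)
    (h_poles : (polesOf h).Finite)
    (h_zeros : {s : ℂ | s ∈ zerosOf h ∧ a < s.re}.Finite)
    (h_line : ∀ s : ℂ, s.re = a → AnalyticAt ℂ h s ∧ h s ≠ 0)
    (h_decay : ∀ η : ℝ, 0 < η → ∃ σ₀ : ℝ, a < σ₀ ∧ ∀ s : ℂ, σ₀ ≤ s.re →
      s ∉ polesOf (reflQuot a h) ∧ ‖reflQuot a h s‖ < η)
    (h_growth : ∀ ε : ℝ, 0 < ε → ∀ σ₀ : ℝ, a < σ₀ → ∃ T : ℕ → ℝ,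
      Filter.Tendsto T Filter.atTop Filter.atTop ∧
      ∀ n : ℕ, ∀ s : ℂ, a ≤ s.re → s.re ≤ σ₀ → |s.im| = T n →
        s ∉ polesOf (reflQuot a h) ∧ ‖reflQuot a h s‖ < Real.exp (ε * ‖s‖)) :
    ∃ T σ c : ℝ, 0 < T ∧ a < σ ∧ 0 < c ∧
      (∀ s : ℂ, a ≤ s.re → T ≤ |s.im| →
        AnalyticAt ℂ h s ∧ h s ≠ 0 ∧ AnalyticAt ℂ h (2 * (a : ℂ) - s)) ∧
      (∀ s : ℂ, a ≤ s.re → s.re ≤ σ → T ≤ |s.im| →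
        ‖reflQuot a h s‖ ≤ Real.exp (-c * (s.re - a))) ∧
      (∀ s : ℂ, σ ≤ s.re → ‖reflQuot a h s‖ < 1) := by
  obtain ⟨T₀, hT₀, hgood⟩ := exists_forall_analyticAt_ne_zero h_mero h_poles h_zeros h_line
  obtain ⟨σ, hσ, hdec⟩ := h_decay (Real.exp (-1)) (Real.exp_pos _)
  have han : ∀ s : ℂ, a ≤ s.re → T₀ ≤ |s.im| → AnalyticAt ℂ (reflQuot a h) s := fun s h1 h2 =>
    have h3 := hgood s h1 h2
    analyticAt_reflQuot h3.1 h3.2.1 h3.2.2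
  have habs : ∀ {x : ℝ}, T₀ ≤ x → T₀ ≤ |x| := fun hx => hx.trans (le_abs_self _)
  have hgrow' : ∀ ε : ℝ, 0 < ε → ∃ t : ℕ → ℝ, Filter.Tendsto t Filter.atTop Filter.atTop ∧
      ∀ n : ℕ, ∀ s : ℂ, a ≤ s.re → s.re ≤ σ → |s.im| = |t n| →
        ‖reflQuot a h s‖ ≤ Real.exp (ε * ‖s‖) := by
    intro ε hε
    obtain ⟨t, ht, hb⟩ := h_growth ε hε σ hσ
    obtain ⟨N, hN⟩ := Filter.eventually_atTop.1 (ht.eventually_ge_atTop 0)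
    refine ⟨fun n => t (n + N), ht.comp (Filter.tendsto_add_atTop_nat N), fun n s h1 h2 h3 => ?_⟩
    rw [abs_of_nonneg (hN (n + N) (Nat.le_add_left _ _))] at h3
    exact (hb _ s h1 h2 h3).2.le
  obtain ⟨T₁, c₁, hc₁, hb₁⟩ := halfStrip_norm_le_exp_neg (F := reflQuot a h) (T := T₀) hσ
    (fun s h1 _ h3 => han s h1 (habs h3))
    (fun s h1 _ => (norm_reflQuot_of_re_eq h_real h_line h1).le)
    (fun s h1 _ => (hdec s h1.ge).2.le)
    (fun ε hε => by
      obtain ⟨t, ht, hb⟩ := hgrow' ε hε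
      exact ⟨t, ht, fun n s h1 h2 h3 => hb n s h1 h2 (by rw [h3])⟩)
  -- The lower half-strip is reached by conjugating both argument and value.
  obtain ⟨T₂, c₂, hc₂, hb₂⟩ := halfStrip_norm_le_exp_neg
    (F := fun s => conj (reflQuot a h (conj s))) (T := T₀) hσ
    (fun s h1 _ h3 => analyticAt_conj_conj (han _ (by simpa using h1) (by simpa using habs h3)))
    (fun s h1 _ => by
      rw [RCLike.norm_conj]
      exact (norm_reflQuot_of_re_eq h_real h_line (by simpa using h1)).le)
    (fun s h1 _ => by
      rw [RCLike.norm_conj]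
      exact (hdec _ (by simpa using h1.ge)).2.le)
    (fun ε hε => by
      obtain ⟨t, ht, hb⟩ := hgrow' ε hε
      refine ⟨t, ht, fun n s h1 h2 h3 => ?_⟩
      simpa using hb n (conj s) (by simpa using h1) (by simpa using h2) (by simp [h3]))
  refine ⟨max T₀ (max T₁ T₂), σ, min c₁ c₂, lt_max_of_lt_left hT₀, hσ, lt_min hc₁ hc₂,
    fun s h1 h2 => hgood s h1 ((le_max_left _ _).trans h2), fun s h1 h2 h3 => ?_,
    fun s h1 => (hdec s h1).2.trans (Real.exp_lt_one_iff.2 (by norm_num))⟩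
  have hx : 0 ≤ s.re - a := sub_nonneg.2 h1
  have hT₁ : T₁ ≤ |s.im| := ((le_max_left _ _).trans (le_max_right _ _)).trans h3
  have hT₂ : T₂ ≤ |s.im| := ((le_max_right _ _).trans (le_max_right _ _)).trans h3
  rcases le_total 0 s.im with him | him
  · rw [abs_of_nonneg him] at hT₁
    refine (hb₁ s h1 h2 hT₁).trans (Real.exp_le_exp.2 ?_)
    nlinarith [min_le_left c₁ c₂]
  · rw [abs_of_nonpos him] at hT₂
    have h4 := hb₂ (conj s) (by simpa using h1) (by simpa using h2) (by simpa using hT₂)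
    simp only [Complex.conj_conj, RCLike.norm_conj, Complex.conj_re] at h4
    refine h4.trans (Real.exp_le_exp.2 ?_)
    nlinarith [min_le_right c₁ c₂]

/-! ### The main theorem -/

theorem mainTheorem2 (a : ℝ) (h : ℂ → ℂ)
    (h_mero : MeromorphicNFOn h Set.univ)
    (h_real : ∀ x : ℝ, (h (x : ℂ)).im = 0)
    (h_poles : (polesOf h).Finite)
    (h_zeros : {s : ℂ | s ∈ zerosOf h ∧ a < s.re}.Finite)
    (h_line : ∀ s : ℂ, s.re = a → AnalyticAt ℂ h s ∧ h s ≠ 0)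
    (h_decay : ∀ η : ℝ, 0 < η → ∃ σ₀ : ℝ, a < σ₀ ∧ ∀ s : ℂ, σ₀ ≤ s.re →
      s ∉ polesOf (reflQuot a h) ∧ ‖reflQuot a h s‖ < η)
    (h_growth : ∀ ε : ℝ, 0 < ε → ∀ σ₀ : ℝ, a < σ₀ → ∃ T : ℕ → ℝ,
      Filter.Tendsto T Filter.atTop Filter.atTop ∧
      ∀ n : ℕ, ∀ s : ℂ, a ≤ s.re → s.re ≤ σ₀ → |s.im| = T n →
        s ∉ polesOf (reflQuot a h) ∧ ‖reflQuot a h s‖ < Real.exp (ε * ‖s‖))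
    (θ : ℝ → ℝ) (hθ : IsPhaseFunction a h θ) :
    (∀ e : ℤˣ,
      (∀ T : ℝ, (criticalZeros a (reflSum a h e) T).Finite) ∧
      (∃ C : ℝ, ∀ T : ℝ, 0 < T →
        |(numCriticalZeros a (reflSum a h e) T : ℝ) - θ T / Real.pi| ≤ C) ∧
      (∃ d : ℕ,
        (∀ᶠ T : ℝ in Filter.atTop,
          (numCriticalZeros a (reflSum a h e) T : ℤ) =
            ⌈θ T / Real.pi - phaseShift e⌉ + (d : ℤ)) ∧
        (MonotoneOn θ (Set.Ici 0) → d = 0))) ∧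
    (∃ T₀ : ℝ, 0 < T₀ ∧
      (∀ e : ℤˣ, ∀ s ∈ zerosOf (reflSum a h e), T₀ < |s.im| →
        s.re = a ∧ meromorphicOrderAt (reflSum a h e) s = 1) ∧
      Interlaced (criticalOrdinates a (reflSum a h 1) ∩ Set.Ioi T₀)
        (criticalOrdinates a (reflSum a h (-1)) ∩ Set.Ioi T₀) ∧
      Interlaced (criticalOrdinates a (reflSum a h 1) ∩ Set.Iio (-T₀))
        (criticalOrdinates a (reflSum a h (-1)) ∩ Set.Iio (-T₀))) := by
  obtain ⟨T, σ, c, hT, hσ, hc, hgood, hstrip, hright⟩ := exists_norm_reflQuot_le_exp h_mero h_real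
    h_poles h_zeros h_line h_decay h_growth
  have hθc : Continuous θ := hθ.1
  have hline' : ∀ (e : ℤˣ) (s : ℂ), s.re = a → AnalyticAt ℂ (reflSum a h e) s := fun e s hs =>
    analyticAt_reflSum e (h_line s hs).1 (h_line _ (by simp [hs]; ring)).1
  have hord : ∀ e : ℤˣ, criticalOrdinates a (reflSum a h e) =
      {τ | ∃ k : ℤ, θ τ / Real.pi - phaseShift e = k} := fun e => by
    ext τ
    rw [criticalOrdinates, Set.mem_ofPred_eq, (hline' e _ (by simp)).mem_zerosOf_iff,
      reflSum_eq_zero_iff h_real h_line hθ]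
    rfl
  have hderivQuot : ∀ s : ℂ, s.re = a → T ≤ |s.im| →
      (deriv (reflQuot a h) s / reflQuot a h s).re ≤ -c := by
    intro s hs hTs
    have h1 := hgood s hs.ge hTs
    refine re_deriv_div_le_of_norm_le_exp
      (analyticAt_reflQuot h1.1 h1.2.1 h1.2.2).differentiableAt.hasDerivAt
      (norm_reflQuot_of_re_eq h_real h_line hs) (sub_pos.2 hσ) fun t ht1 ht2 => ?_
    have h2 := hstrip (s + t) (by simp [hs, ht1.le]) (by simp [hs]; linarith) (by simpa using hTs)
    simpa [hs] using h2
  have hderivθ : ∀ τ : ℝ, T ≤ |τ| → 0 < deriv θ τ := by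
    intro τ hτ
    set s : ℂ := (a : ℂ) + (τ : ℂ) * Complex.I with hs
    have hre : s.re = a := by simp [hs]
    have him : s.im = τ := by simp [hs]
    have h1 := hgood s hre.ge (by rwa [him])
    have h2 := (analyticAt_reflQuot h1.1 h1.2.1 h1.2.2).differentiableAt.hasDerivAt
    have h3 : HasDerivAt (fun t : ℝ => (a : ℂ) + (t : ℂ) * Complex.I) Complex.I τ := by
      simpa using ((Complex.ofRealCLM.hasDerivAt (x := τ)).mul_const Complex.I).const_add (a : ℂ)
    have h4 := HasDerivAt.comp (h₂ := reflQuot a h) τ h2 h3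
    have h5 : (reflQuot a h ∘ fun t : ℝ => (a : ℂ) + (t : ℂ) * Complex.I) =
        fun t : ℝ => Complex.exp (((-2 * θ t : ℝ) : ℂ) * Complex.I) :=
      funext fun t => reflQuot_eq_cexp h_real h_line hθ t
    rw [h5] at h4
    -- Along the line the chain rule gives `i F'/F = -2iθ'`, so `θ' = -Re (F'/F) / 2 ≥ c/2`.
    have h6 := hasDerivAt_of_hasDerivAt_cexp hθc (by norm_num) h4
    rw [h6.deriv, ← reflQuot_eq_cexp h_real h_line hθ τ, ← hs, mul_div_right_comm, Complex.mul_I_im]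
    have h7 := hderivQuot s hre (by rwa [him])
    linarith
  have hmono : StrictMonoOn θ (Set.Ici T) :=
    strictMonoOn_of_deriv_pos (convex_Ici T) hθc.continuousOn fun τ hτ => by
      rw [interior_Ici] at hτ
      exact hderivθ τ (hτ.le.trans (le_abs_self τ))
  have hmono' : StrictMonoOn θ (Set.Iic (-T)) :=
    strictMonoOn_of_deriv_pos (convex_Iic (-T)) hθc.continuousOn fun τ hτ => by
      rw [interior_Iic] at hτ
      exact hderivθ τ ((le_neg.1 hτ.le).trans (neg_le_abs τ))
  have hscale : ∀ (u : ℝ) {I : Set ℝ}, StrictMonoOn θ I →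
      StrictMonoOn (fun τ => θ τ / Real.pi - u) I := fun u I hI x hx y hy hxy =>
    sub_lt_sub_right (div_lt_div_of_pos_right (hI hx hy hxy) Real.pi_pos) u
  have hinj : Function.Injective fun τ : ℝ => (a : ℂ) + (τ : ℂ) * Complex.I := fun x y hxy => by
    simpa using congrArg Complex.im hxy
  refine ⟨fun e => ?_, T, hT, fun e s hs hTs => ?_, ?_, ?_⟩
  · set φ : ℝ → ℝ := fun τ => θ τ / Real.pi - phaseShift e with hφ
    have hφc : Continuous φ := by fun_prop
    have hu : 0 < phaseShift e ∧ phaseShift e ≤ 1 := by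
      rw [phaseShift]; split_ifs <;> norm_num
    have hφ0 : φ 0 = -phaseShift e := by simp [hφ, hθ.2.1]
    have hφm : StrictMonoOn φ (Set.Ici T) := hscale _ hmono
    have hcrit : ∀ S, criticalZeros a (reflSum a h e) S =
        (fun τ : ℝ => (a : ℂ) + (τ : ℂ) * Complex.I) ''
          ({τ | ∃ k : ℤ, φ τ = k} ∩ Set.Ioo 0 S) := by
      intro S
      rw [← hord e]
      ext s
      constructor
      · rintro ⟨h1, h2, h3, h4⟩
        have hs : (a : ℂ) + (s.im : ℂ) * Complex.I = s := by rw [← h2, Complex.re_add_im]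
        exact ⟨s.im, ⟨by rwa [criticalOrdinates, Set.mem_ofPred_eq, hs], h3, h4⟩, hs⟩
      · rintro ⟨τ, ⟨h1, h2, h3⟩, rfl⟩
        exact ⟨h1, by simp, by simpa using h2, by simpa using h3⟩
    have hfin : ∀ S, (criticalZeros a (reflSum a h e) S).Finite := by
      intro S
      by_contra hinf
      have hK : IsCompact ({a} ×ℂ Set.Icc 0 S) := isCompact_singleton.reProdIm isCompact_Icc
      obtain ⟨x, hx, hacc⟩ := Set.Infinite.exists_accPt_of_subset_isCompact hinf hK
        fun s hs => ⟨hs.2.1, hs.2.2.1.le, hs.2.2.2.le⟩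
      rw [accPt_iff_frequently_nhdsNE] at hacc
      -- Infinitely many zeros would accumulate on the segment, so `f` would vanish on the whole
      -- line and `φ` would be integer-valued.
      have hzero := AnalyticOnNhd.eqOn_zero_of_preconnected_of_frequently_eq_zero
        (f := reflSum a h e) (U := {s : ℂ | s.re = a}) (hline' e) (isPreconnected_re_eq a) hx.1
        (hacc.mono fun z hz => (hline' e z hz.2.1).mem_zerosOf_iff.1 hz.1)
      have hall : ∀ τ, ∃ k : ℤ, φ τ = k := fun τ =>
        (reflSum_eq_zero_iff h_real h_line hθ e τ).1 (hzero (by simp))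
      have hcount := ncard_integer_values_of_strictMonoOn hφc hφm (T := T + 1) (by linarith)
      have huniv : {τ | ∃ k : ℤ, φ τ = k} = Set.univ := Set.eq_univ_of_forall hall
      -- `ncard` of an infinite set is `0`, whereas the count formula gives a positive number.
      rw [huniv, Set.univ_inter, (Set.Ico_infinite (by linarith)).ncard] at hcount
      obtain ⟨k, hk⟩ := hall T
      obtain ⟨m, hm⟩ := hall (T + 1)
      have hlt := hφm Set.self_mem_Ici (Set.mem_Ici.2 (by linarith)) (lt_add_one T)
      rw [hk, hm] at hcount hlt
      rw [Int.ceil_intCast, Int.ceil_intCast] at hcount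
      have : k < m := by exact_mod_cast hlt
      push_cast at hcount
      omega
    have hfin' : ∀ S, ({τ | ∃ k : ℤ, φ τ = k} ∩ Set.Ioo 0 S).Finite := fun S =>
      Set.Finite.of_finite_image (hcrit S ▸ hfin S) hinj.injOn
    have hnum : ∀ S, numCriticalZeros a (reflSum a h e) S =
        ({τ | ∃ k : ℤ, φ τ = k} ∩ Set.Ioo 0 S).ncard := fun S => by
      rw [numCriticalZeros, hcrit, Set.ncard_image_of_injective _ hinj]
    obtain ⟨⟨C, hC⟩, d, hd, hd0⟩ := ncard_integer_values_asymptotic hφc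
      (by rw [hφ0]; linarith [hu.2]) (by rw [hφ0]; linarith [hu.1]) hT hφm hfin'
    refine ⟨hfin, ⟨C + 1, fun S hS => ?_⟩, d, ?_, fun hm => hd0 fun x hx y hy hxy => ?_⟩
    · have h1 := abs_le.1 (hC S hS)
      rw [hnum, abs_le]
      simp only [hφ] at h1 ⊢
      constructor <;> linarith [h1.1, h1.2, hu.1, hu.2]
    · filter_upwards [Filter.eventually_ge_atTop T] with S hS
      rw [hnum]
      exact hd S hS
    · exact sub_le_sub_right (div_le_div_of_nonneg_right (hm hx hy hxy) Real.pi_pos.le) _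
  · have he : (((e : ℤ) : ℂ)) ≠ 0 := by
      rcases Int.units_eq_one_or e with rfl | rfl <;> simp
    have hne : ∀ z : ℂ, a < z.re → T ≤ |z.im| → reflSum a h e z ≠ 0 := by
      intro z hz hTz h0
      have h1 := hgood z hz.le hTz
      rw [reflSum_eq_mul e h1.2.1, mul_eq_zero, or_iff_right h1.2.1] at h0
      have h2 : ‖((e : ℤ) : ℂ) * reflQuot a h z‖ = 1 := by
        rw [(eq_neg_of_add_eq_zero_right h0), norm_neg, norm_one]
      have h3 : ‖((e : ℤ) : ℂ)‖ = 1 := by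
        rcases Int.units_eq_one_or e with rfl | rfl <;> simp
      rw [norm_mul, h3, one_mul] at h2
      refine absurd h2 (ne_of_lt ?_)
      rcases le_total z.re σ with hzσ | hzσ
      · refine (hstrip z hz.le hzσ hTz).trans_lt (Real.exp_lt_one_iff.2 ?_)
        nlinarith
      · exact hright z hzσ
    rcases lt_trichotomy s.re a with hlt | heq | hgt
    · have h1 := hgood (2 * (a : ℂ) - s) (by simp; linarith) (by simpa using hTs.le)
      have h2 : AnalyticAt ℂ (reflSum a h e) s :=
        analyticAt_reflSum e (by simpa using h1.2.2) h1.1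
      have h3 := h2.mem_zerosOf_iff.1 hs
      refine absurd ?_ (hne (2 * (a : ℂ) - s) (by simp; linarith) (by simpa using hTs.le))
      rw [reflSum_reflect, h3, mul_zero]
    · have h1 := hgood s heq.ge hTs.le
      have h2 := hline' e s heq
      have h3 := h2.mem_zerosOf_iff.1 hs
      refine ⟨heq, ?_⟩
      have hq := (analyticAt_reflQuot h1.1 h1.2.1 h1.2.2).differentiableAt.hasDerivAt
      -- At a zero the factor `1 ± F` vanishes, leaving `f' = ±h F'`, and `Re (F'/F) ≤ -c` rules out
      -- `F' = 0`.
      have h4 : HasDerivAt (reflSum a h e)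
          (deriv h s * (1 + ((e : ℤ) : ℂ) * reflQuot a h s) +
            h s * (((e : ℤ) : ℂ) * deriv (reflQuot a h) s)) s := by
        refine (h1.1.differentiableAt.hasDerivAt.fun_mul
          ((hq.const_mul ((e : ℤ) : ℂ)).const_add 1)).congr_of_eventuallyEq ?_
        filter_upwards [h1.1.continuousAt.eventually_ne h1.2.1] with z hz
        exact reflSum_eq_mul e hz
      have h5 : (1 + ((e : ℤ) : ℂ) * reflQuot a h s) = 0 := by
        rw [reflSum_eq_mul e h1.2.1, mul_eq_zero, or_iff_right h1.2.1] at h3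
        exact h3
      have h6 : deriv (reflQuot a h) s ≠ 0 := by
        intro h0
        have := hderivQuot s heq hTs.le
        rw [h0, zero_div, Complex.zero_re] at this
        linarith
      have h7 : deriv (reflSum a h e) s ≠ 0 := by
        rw [h4.deriv, h5, mul_zero, zero_add]
        exact mul_ne_zero h1.2.1 (mul_ne_zero he h6)
      rw [h2.meromorphicOrderAt_eq, h2.analyticOrderAt_eq_one_of_zero_deriv_ne_zero h3 h7]
      rfl
    · have h1 := hgood s hgt.le hTs.le
      exact absurd ((analyticAt_reflSum e h1.1 h1.2.2).mem_zerosOf_iff.1 hs) (hne s hgt hTs.le)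
  · rw [hord, hord]
    exact interlaced_of_strictMonoOn (φ := fun τ => θ τ / Real.pi) (by fun_prop)
      (by simpa using hscale 0 (hmono.mono Set.Ioi_subset_Ici_self)) Set.ordConnected_Ioi
  · rw [hord, hord]
    exact interlaced_of_strictMonoOn (φ := fun τ => θ τ / Real.pi) (by fun_prop)
      (by simpa using hscale 0 (hmono'.mono Set.Iio_subset_Iic_self)) Set.ordConnected_Iio
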